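/- Let $n,m$ be natural numbers, let $\mathbb{S}^n$ be the space of real symmetric $n\times n$ matrices with inner product $\langle U,V\rangle=\mathrm{tr}(UV)$, let $\mathbb{S}^n_+\subset\mathbb{S}^n$ be the cone of positive semidefinite matrices, and equip $\mathbb{R}^{n\times m}$ with the inner product $\langle A,B\rangle=\mathrm{tr}(A^TB)$. For $M\subset\mathbb{S}^n_+$ the variational Gram function $\Omega_M:\mathbb{R}^{n\times m}\to\mathbb{R}\cup\{+\infty\}$ is $$\Omega_M(X)=\tfrac12\,\sigma_M(XX^T)=\tfrac12\sup_{V\in M}\langle XX^T,V\rangle .$$ The subdifferential of a function $f:\mathbb{R}^{n\times m}\to\mathbb{R}\cup\{+\infty\}$ at a point $X$ with $f(X)<+\infty$ is $$\partial f(X)=\{D\in\mathbb{R}^{n\times m} : f(X)+\langle D,Y-X\rangle\le f(Y)\ \text{ for all } Y\in\mathbb{R}^{n\times m}\},$$ and $\partial f(X)=\emptyset$ if $f(X)=+\infty$. Let $M\subset\mathbb{S}^n_+$ be nonempty, convex and compact. Then, for every $X\in\mathbb{R}^{n\times m}$, $$\partial\Omega_M(X)=\Bigl\{VX : V\in\mathop{\mathrm{argmax}}_{M}\,\langle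 XX^T,\cdot\rangle\Bigr\},$$ where $\mathop{\mathrm{argmax}}_{M}\langle XX^T,\cdot\rangle=\{V\in M : \langle XX^T,W\rangle\le\langle XX^T,V\rangle\ \text{ for all } W\in M\}$. -/

import Mathlib

noncomputable section

namespace VGF

/-- The trace inner product `⟨A, B⟩ = tr (Aᵀ B)` on real `n × m` matrices.  For symmetric `A`
(and `n = m`) this is `tr (A B)`, the inner product of the space of symmetric matrices. -/
def traceInner {n m : ℕ} (A B : Matrix (Fin n) (Fin m) ℝ) : ℝ :=
  (A.transpose * B).trace

/-- The (extended real-valued) support function `σ_S(U) = sup_{V ∈ S} ⟨U, V⟩`. -/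
def supportFun {n m : ℕ} (S : Set (Matrix (Fin n) (Fin m) ℝ)) (U : Matrix (Fin n) (Fin m) ℝ) :
    EReal :=
  ⨆ V ∈ S, (traceInner U V : EReal)

/-- The variational Gram function `Ω_M(X) = (1/2) σ_M(X Xᵀ)`. -/
def gramFun {n : ℕ} (M : Set (Matrix (Fin n) (Fin n) ℝ)) (m : ℕ)
    (X : Matrix (Fin n) (Fin m) ℝ) : EReal :=
  ((1 / 2 : ℝ) : EReal) * supportFun M (X * X.transpose)

/-- The convex-analytic subdifferential of an extended real-valued function on `ℝ^{n × m}`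
(with the trace inner product) at `X`; it is empty when `X` is outside the domain
`{X | f X < +∞}`. -/
def subdifferential {n m : ℕ} (f : Matrix (Fin n) (Fin m) ℝ → EReal)
    (X : Matrix (Fin n) (Fin m) ℝ) : Set (Matrix (Fin n) (Fin m) ℝ) :=
  {D | f X < ⊤ ∧ ∀ Y, f X + (traceInner D (Y - X) : EReal) ≤ f Y}

/-- The set of maximizers of `f` over `S`. -/
def argmaxOn {α : Type*} (S : Set α) (f : α → ℝ) : Set α :=
  {V | V ∈ S ∧ IsMaxOn f S V}

end VGF

end

namespace VGF

open Filter Topology Matrix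

variable {n m : ℕ}

/-! This is Danskin's theorem: the function is a maximum over `M` of the quadratics `Y ↦ ½⟨YYᵀ, V⟩`,
each convex with gradient `VX` at `X`. If `V` is maximal at `X`, its exact expansion
(`traceInner_gram_add`), minus the nonnegative second-order term, is the subgradient inequality for
`VX`. Conversely, the matrices `VX` with `V` maximal form a compact convex set. A subgradient `D`
outside it would be strictly separated from it by a direction `H`, whereas
`exists_argmaxOn_traceInner_ge` gives a maximal `V` with `⟨D, H⟩ ≤ ⟨VX, H⟩`. -/

lemma traceInner_eq_sum (A B : Matrix (Fin n) (Fin m) ℝ) :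
    traceInner A B = ∑ i, ∑ j, A i j * B i j := by
  simp only [traceInner, Matrix.trace, Matrix.diag, Matrix.mul_apply, Matrix.transpose_apply]
  exact Finset.sum_comm

lemma continuous_traceInner :
    Continuous fun p : Matrix (Fin n) (Fin m) ℝ × Matrix (Fin n) (Fin m) ℝ =>
      traceInner p.1 p.2 := by
  unfold traceInner
  fun_prop

lemma traceInner_smul_right (A B : Matrix (Fin n) (Fin m) ℝ) (t : ℝ) :
    traceInner A (t • B) = t * traceInner A B := by
  simp [traceInner]

/-- Second-order expansion of `Y ↦ ⟨Y Yᵀ, V⟩` for symmetric `V`. -/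
lemma traceInner_gram_add {V : Matrix (Fin n) (Fin n) ℝ} (hV : Vᵀ = V)
    (X H : Matrix (Fin n) (Fin m) ℝ) :
    traceInner ((X + H) * (X + H)ᵀ) V =
      traceInner (X * Xᵀ) V + 2 * traceInner (V * X) H + traceInner (H * Hᵀ) V := by
  have h1 : (X * Hᵀ * V).trace = (Xᵀ * V * H).trace := by
    rw [← Matrix.trace_transpose]
    simp only [Matrix.transpose_mul, Matrix.transpose_transpose, hV]
    rw [← Matrix.mul_assoc, Matrix.trace_mul_comm, ← Matrix.mul_assoc]
  have h2 : (H * Xᵀ * V).trace = (Xᵀ * V * H).trace := by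
    rw [Matrix.mul_assoc, Matrix.trace_mul_comm]
  simp only [traceInner, Matrix.transpose_mul, Matrix.transpose_add, Matrix.transpose_transpose,
    hV, Matrix.add_mul, Matrix.mul_add, Matrix.trace_add, h1, h2]
  ring

lemma transpose_eq_of_posSemidef {V : Matrix (Fin n) (Fin n) ℝ} (hV : V.PosSemidef) :
    Vᵀ = V := by
  simpa [Matrix.IsHermitian, Matrix.conjTranspose_eq_transpose_of_trivial] using hV.isHermitian

/-- The value is the trace of the positive semidefinite matrix `HᵀVH`. -/
lemma traceInner_gram_nonneg {V : Matrix (Fin n) (Fin n) ℝ} (hV : V.PosSemidef)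
    (H : Matrix (Fin n) (Fin m) ℝ) : 0 ≤ traceInner (H * Hᵀ) V := by
  have h := (hV.conjTranspose_mul_mul_same H).trace_nonneg
  rw [Matrix.conjTranspose_eq_transpose_of_trivial, Matrix.mul_assoc, Matrix.trace_mul_comm,
    Matrix.mul_assoc, Matrix.trace_mul_comm] at h
  simpa [traceInner] using h

lemma gramFun_eq_of_mem_argmaxOn {M : Set (Matrix (Fin n) (Fin n) ℝ)}
    {Y : Matrix (Fin n) (Fin m) ℝ} {V : Matrix (Fin n) (Fin n) ℝ}
    (hV : V ∈ argmaxOn M fun V => traceInner (Y * Yᵀ) V) :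
    gramFun M m Y = ((1 / 2 * traceInner (Y * Yᵀ) V : ℝ) : EReal) := by
  have : supportFun M (Y * Yᵀ) = (traceInner (Y * Yᵀ) V : EReal) :=
    le_antisymm (iSup₂_le fun W hW => EReal.coe_le_coe_iff.2 (hV.2 hW))
      (le_iSup₂ (f := fun W (_ : W ∈ M) => (traceInner (Y * Yᵀ) W : EReal)) V hV.1)
  rw [gramFun, this, EReal.coe_mul]

lemma argmaxOn_nonempty {M : Set (Matrix (Fin n) (Fin n) ℝ)} (hne : M.Nonempty)
    (hcpt : IsCompact M) (U : Matrix (Fin n) (Fin n) ℝ) :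
    (argmaxOn M fun V => traceInner U V).Nonempty :=
  hcpt.exists_isMaxOn hne
    (continuous_traceInner.comp (Continuous.prodMk_right U)).continuousOn

lemma isCompact_argmaxOn {M : Set (Matrix (Fin n) (Fin n) ℝ)} (hcpt : IsCompact M)
    (U : Matrix (Fin n) (Fin n) ℝ) : IsCompact (argmaxOn M fun V => traceInner U V) := by
  have hc : Continuous fun V : Matrix (Fin n) (Fin n) ℝ => traceInner U V :=
    continuous_traceInner.comp (Continuous.prodMk_right U)
  have : (argmaxOn M fun V => traceInner U V) =
      M ∩ ⋂ W ∈ M, {V | traceInner U W ≤ traceInner U V} := by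
    ext V
    simp [argmaxOn, isMaxOn_iff]
  rw [this]
  exact hcpt.inter_right (isClosed_biInter fun W _ => isClosed_le continuous_const hc)

lemma convex_argmaxOn {M : Set (Matrix (Fin n) (Fin n) ℝ)} (hconv : Convex ℝ M)
    (U : Matrix (Fin n) (Fin n) ℝ) : Convex ℝ (argmaxOn M fun V => traceInner U V) := by
  intro V hV W hW a b ha hb hab
  refine ⟨hconv hV.1 hW.1 ha hb hab, fun Z hZ => ?_⟩
  have h1 : traceInner U Z ≤ traceInner U V := hV.2 hZ
  have h2 : traceInner U Z ≤ traceInner U W := hW.2 hZ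
  have h3 : traceInner U (a • V + b • W) = a * traceInner U V + b * traceInner U W := by
    simp [traceInner, Matrix.mul_add]
  change traceInner U Z ≤ traceInner U (a • V + b • W)
  rw [h3]
  calc traceInner U Z = a * traceInner U Z + b * traceInner U Z := by rw [← add_mul, hab, one_mul]
    _ ≤ _ := by gcongr

/-- Strict separation of a point from a compact convex set of matrices in terms of the trace
inner product. -/
lemma exists_traceInner_lt {S : Set (Matrix (Fin n) (Fin m) ℝ)} (hS : Convex ℝ S)
    (hcpt : IsCompact S) {D : Matrix (Fin n) (Fin m) ℝ} (hD : D ∉ S) :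
    ∃ H, ∀ A ∈ S, traceInner A H < traceInner D H := by
  have : LocallyConvexSpace ℝ (Matrix (Fin n) (Fin m) ℝ) :=
    inferInstanceAs (LocallyConvexSpace ℝ (Fin n → Fin m → ℝ))
  obtain ⟨f, u, hf, hu⟩ := geometric_hahn_banach_closed_point hS hcpt.isClosed hD
  -- Riesz representation of `f`: the entries of the representing matrix are the values of `f` on
  -- the matrix units.
  have key : ∀ A, f A = traceInner A (Matrix.of fun i j => f (Matrix.single i j 1)) := by
    intro A
    conv_lhs => rw [Matrix.matrix_eq_sum_single A]
    rw [traceInner_eq_sum, map_sum]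
    refine Finset.sum_congr rfl fun i _ => ?_
    rw [map_sum]
    refine Finset.sum_congr rfl fun j _ => ?_
    have : Matrix.single i j (A i j) = A i j • Matrix.single i j (1 : ℝ) := by
      simp [Matrix.smul_single]
    rw [this, map_smul, smul_eq_mul, Matrix.of_apply]
  refine ⟨Matrix.of fun i j => f (Matrix.single i j 1), fun A hA => ?_⟩
  rw [← key, ← key]
  exact (hf A hA).trans hu

/-- A subgradient of the variational Gram function is dominated, in every direction, by some
`V X` with `V` a maximizer. -/
lemma exists_argmaxOn_traceInner_ge {M : Set (Matrix (Fin n) (Fin n) ℝ)}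
    (hpsd : ∀ V ∈ M, V.PosSemidef) (hne : M.Nonempty) (hcpt : IsCompact M)
    {X D : Matrix (Fin n) (Fin m) ℝ} (hD : D ∈ subdifferential (gramFun M m) X)
    (H : Matrix (Fin n) (Fin m) ℝ) :
    ∃ V ∈ argmaxOn M fun V => traceInner (X * Xᵀ) V,
      traceInner D H ≤ traceInner (V * X) H := by
  obtain ⟨V₀, hV₀⟩ := argmaxOn_nonempty hne hcpt (X * Xᵀ)
  choose V hV using fun t : ℝ =>
    argmaxOn_nonempty hne hcpt ((X + t • H) * (X + t • H)ᵀ)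
  -- Along an ultrafilter finer than `t ↓ 0`, compactness makes the maximizers `V t` at `X + tH`
  -- converge without passing to a subsequence; by continuity the limit is a maximizer at `X`.
  let F : Ultrafilter ℝ := Ultrafilter.of (𝓝[>] (0 : ℝ))
  have hF : (F : Filter ℝ) ≤ 𝓝[>] 0 := Ultrafilter.of_le _
  obtain ⟨W, hWM, hW⟩ := hcpt.ultrafilter_le_nhds (F.map V)
    (le_principal_iff.2 (Filter.mem_map.2 (Filter.univ_mem' fun t => (hV t).1)))
  have hVW : Tendsto V F (𝓝 W) := hW
  have ht : Tendsto (fun t : ℝ => t) F (𝓝 0) := hF.trans nhdsWithin_le_nhds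
  have hY : Tendsto (fun t : ℝ => (X + t • H) * (X + t • H)ᵀ) F (𝓝 (X * Xᵀ)) := by
    have hc : Continuous fun t : ℝ => (X + t • H) * (X + t • H)ᵀ := by fun_prop
    simpa [Function.comp_def] using (hc.tendsto 0).comp ht
  refine ⟨W, ⟨hWM, fun Z hZ => ?_⟩, ?_⟩
  · exact le_of_tendsto_of_tendsto
      ((continuous_traceInner.tendsto (X * Xᵀ, Z)).comp (hY.prodMk_nhds tendsto_const_nhds))
      ((continuous_traceInner.tendsto (X * Xᵀ, W)).comp (hY.prodMk_nhds hVW))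
      (Eventually.of_forall fun t => (hV t).2 hZ)
  · have hlim : Tendsto
        (fun t : ℝ => traceInner (V t * X) H + t / 2 * traceInner (H * Hᵀ) (V t)) F
        (𝓝 (traceInner (W * X) H)) := by
      have hc : Continuous fun p : ℝ × Matrix (Fin n) (Fin n) ℝ =>
          traceInner (p.2 * X) H + p.1 / 2 * traceInner (H * Hᵀ) p.2 := by
        unfold traceInner
        fun_prop
      simpa [Function.comp_def] using (hc.tendsto (0, W)).comp (ht.prodMk_nhds hVW)
    refine ge_of_tendsto hlim (hF ?_)
    filter_upwards [self_mem_nhdsWithin] with t (htpos : 0 < t)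
    have h := hD.2 (X + t • H)
    rw [gramFun_eq_of_mem_argmaxOn hV₀, gramFun_eq_of_mem_argmaxOn (hV t), ← EReal.coe_add,
      EReal.coe_le_coe_iff, add_sub_cancel_left, traceInner_smul_right,
      traceInner_gram_add (transpose_eq_of_posSemidef (hpsd _ (hV t).1)),
      traceInner_smul_right] at h
    -- Optimality of `V₀` at `X` removes the zeroth-order terms from `h`; every remaining term
    -- carries a factor `t > 0`, which is then cancelled.
    have h0 : traceInner (X * Xᵀ) (V t) ≤ traceInner (X * Xᵀ) V₀ := hV₀.2 (hV t).1
    have hq : traceInner ((t • H) * (t • H)ᵀ) (V t) =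
        t * (t * traceInner (H * Hᵀ) (V t)) := by
      simp [traceInner]
    rw [hq] at h
    refine le_of_mul_le_mul_left ?_ htpos
    linarith

lemma mul_mem_subdifferential_gramFun {M : Set (Matrix (Fin n) (Fin n) ℝ)}
    (hpsd : ∀ V ∈ M, V.PosSemidef) (hne : M.Nonempty) (hcpt : IsCompact M)
    {X : Matrix (Fin n) (Fin m) ℝ} {V : Matrix (Fin n) (Fin n) ℝ}
    (hV : V ∈ argmaxOn M fun V => traceInner (X * Xᵀ) V) :
    V * X ∈ subdifferential (gramFun M m) X := by
  refine ⟨by rw [gramFun_eq_of_mem_argmaxOn hV]; exact EReal.coe_lt_top _, fun Y => ?_⟩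
  obtain ⟨W, hW⟩ := argmaxOn_nonempty hne hcpt (Y * Yᵀ)
  rw [gramFun_eq_of_mem_argmaxOn hV, gramFun_eq_of_mem_argmaxOn hW, ← EReal.coe_add,
    EReal.coe_le_coe_iff]
  have h1 : traceInner (Y * Yᵀ) V ≤ traceInner (Y * Yᵀ) W := hW.2 hV.1
  have h2 := traceInner_gram_add (transpose_eq_of_posSemidef (hpsd V hV.1)) X (Y - X)
  have h3 := traceInner_gram_nonneg (hpsd V hV.1) (Y - X)
  rw [add_sub_cancel] at h2
  linarith

end VGF

theorem mainTheorem10 {n m : ℕ} (M : Set (Matrix (Fin n) (Fin n) ℝ))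
    (hpsd : ∀ V ∈ M, V.PosSemidef) (hne : M.Nonempty) (hconv : Convex ℝ M) (hcpt : IsCompact M)
    (X : Matrix (Fin n) (Fin m) ℝ) :
    VGF.subdifferential (VGF.gramFun M m) X =
      {D | ∃ V ∈ VGF.argmaxOn M (fun V => VGF.traceInner (X * X.transpose) V), D = V * X} := by
  ext D
  constructor
  · intro hD
    by_contra hcon
    have hS : D ∉ (fun V : Matrix (Fin n) (Fin n) ℝ => V * X) ''
        VGF.argmaxOn M (fun V => VGF.traceInner (X * X.transpose) V) := by
      rintro ⟨V, hV, rfl⟩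
      exact hcon ⟨V, hV, rfl⟩
    obtain ⟨H, hH⟩ := VGF.exists_traceInner_lt
      ((VGF.convex_argmaxOn hconv _).is_linear_image
        ⟨fun A B => Matrix.add_mul A B X, fun c A => Matrix.smul_mul c A X⟩)
      ((VGF.isCompact_argmaxOn hcpt _).image (by fun_prop)) hS
    obtain ⟨V, hV, hle⟩ := VGF.exists_argmaxOn_traceInner_ge hpsd hne hcpt hD H
    exact (hH _ ⟨V, hV, rfl⟩).not_ge hle
  · rintro ⟨V, hV, rfl⟩
    exact VGF.mul_mem_subdifferential_gramFun hpsd hne hcpt hV
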